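/- Consider a stationary memoryless channel and an $(n,k,P_\tau,\epsilon)$ variable-length stop-feedback (VLSF) code for it: with common randomness $U$ shared by encoder and decoder, a message uniform on $2^k$ values is mapped to an infinite codeword, which is sent in frames of $n\ge 1$ channel uses until a stopping time $\tau$ (a nonnegative integer number of frames, depending only on $U$ and on the received frames, with law $P_\tau$); the decoder then outputs an estimate that is wrong with probability at most $\epsilon$. In the frame-asynchronous model, a packet arrives in each channel use $t=1,2,\dots$ with probability $\lambda\in(0,1]$, independently across channel uses. Packets are served one at a time, first come first served, starting with an empty system; the $m$th packet is served for $n\tau_m$ channel uses, where $\tau_1,\tau_2,\dots$ are i.i.d. with law $P_\tau$ and independent of the arrivals, and its transmission starts in the channel use that follows the later of its arrival and the departure of the previous packet (a $Geo/G/1$ queue). Let $D_m$ be the delay (waiting time plus service time) of the $m$th packet in channel uses, and for a nonnegative integer-valued random variable $V$ let $G_V(s)=\mathbb{E}[s^V]$. If $\mathbb{E}[\tau]<\infty$ and $\lambda n\mathbb{E}[\tau]<1$, then the law of $D_m$ converges as $m\to\infty$ to a probability distribution on $\{0,1,2,\dots\}$ (the steady-state distribution), and if $D$ has this distribution, then for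 every complex $s\ne 1$ with $\mathbb{E}[|s|^{D}]<\infty$ (in particular for every $s\neq 1$ with $|s|\le 1$) the denominator below is nonzero and $$G_D(s)=\frac{\bigl(1-\lambda n\mathbb{E}[\tau]\bigr)(s-1)\,G_\tau(s^n)}{s-1+\lambda\bigl(1-G_\tau(s^n)\bigr)} .$$ -/

import Mathlib

open MeasureTheory ProbabilityTheory Filter Topology

/-! ### Variable-length stop-feedback codes over a stationary memoryless channel -/

/-- Law of the (infinite) channel output sequence of the stationary memoryless channel `W`
when the input sequence is `x`: the outputs are independent, the `i`-th one has law `W (x i)`. -/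
noncomputable def memorylessOutput {X Y : Type*} [MeasurableSpace X] [MeasurableSpace Y]
    (W : Kernel X Y) [IsMarkovKernel W] : Kernel (ℕ → X) (ℕ → Y) where
  toFun x := Measure.infinitePi fun i => W (x i)
  measurable' := by
    refine Measurable.measure_of_isPiSystem_of_isProbabilityMeasure
      (generateFrom_squareCylinders (α := fun _ : ℕ => Y)).symm
      (isPiSystem_squareCylinders (fun _ => MeasurableSpace.isPiSystem_measurableSet) (by simp)) ?_
    rintro _ ⟨s, t, ht, rfl⟩
    have ht' : ∀ i, MeasurableSet (t i) := fun i => ht i (Set.mem_univ i)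
    have h : (fun x : ℕ → X => Measure.infinitePi (fun i => W (x i)) ((s : Set ℕ).pi t))
        = fun x => ∏ i ∈ s, W (x i) (t i) := by
      funext x
      exact Measure.infinitePi_pi _ fun i _ => ht' i
    rw [h]
    exact Finset.measurable_prod _ fun i _ =>
      (W.measurable_coe (ht' i)).comp (measurable_pi_apply i)

/-- Sample space of one transmission: common randomness, message, received sequence. -/
abbrev CodeSpace (U Y : Type*) (k : ℕ) : Type _ := U × Fin (2 ^ k) × (ℕ → Y)

/-- What the receiver knows after `t` frames of `n` channel uses: the common randomness and the
first `n * t` received symbols. -/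
def receiverView {U Y : Type*} (n k t : ℕ) (ω : CodeSpace U Y k) : U × (Fin (n * t) → Y) :=
  (ω.1, fun i => ω.2.2 i)

lemma measurable_receiverView {U Y : Type*} [MeasurableSpace U] [MeasurableSpace Y]
    (n k t : ℕ) : Measurable (receiverView (U := U) (Y := Y) n k t) := by
  unfold receiverView
  fun_prop

/-- The filtration generated by the common randomness and the received frames. -/
def frameFiltration (U Y : Type*) [MeasurableSpace U] [MeasurableSpace Y] (n k : ℕ) :
    Filtration ℕ (inferInstance : MeasurableSpace (CodeSpace U Y k)) where
  seq t := MeasurableSpace.comap (receiverView n k t) inferInstance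
  mono' := by
    intro t t' htt'
    have hle : n * t ≤ n * t' := Nat.mul_le_mul_left n htt'
    have hcomp : receiverView (U := U) (Y := Y) n k t =
        (fun p : U × (Fin (n * t') → Y) => (p.1, fun i : Fin (n * t) => p.2 (Fin.castLE hle i)))
          ∘ receiverView n k t' := rfl
    change MeasurableSpace.comap (receiverView n k t) _ ≤ _
    rw [hcomp, ← MeasurableSpace.comap_comp]
    exact MeasurableSpace.comap_mono (Measurable.comap_le (by fun_prop))
  le' t := (measurable_receiverView n k t).comap_le

/-- The ingredients of a variable-length stop-feedback code with frames of `n` channel uses and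
`k` information bits: common randomness, encoder into infinite codewords, one decoder for each
number of received frames, and a stopping time that depends only on the common randomness and the
received frames. -/
structure VLSFScheme (U X Y : Type*) [MeasurableSpace U] [MeasurableSpace X] [MeasurableSpace Y]
    (n k : ℕ) where
  /-- law of the common randomness -/
  commonLaw : Measure U
  isProb : IsProbabilityMeasure commonLaw
  encoder : U × Fin (2 ^ k) → (ℕ → X)
  measurable_encoder : Measurable encoder
  decoder : (t : ℕ) → U × (Fin (n * t) → Y) → Fin (2 ^ k)
  measurable_decoder : ∀ t, Measurable (decoder t)
  /-- the number of frames used -/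
  tau : CodeSpace U Y k → ℕ
  isStoppingTime : IsStoppingTime (frameFiltration U Y n k) fun ω => (tau ω : WithTop ℕ)

section
variable {U X Y : Type*} [MeasurableSpace U] [MeasurableSpace X] [MeasurableSpace Y] {n k : ℕ}

/-- Joint law of common randomness, (uniform, independent) message and received sequence, when the
codeword is sent over the stationary memoryless channel `W`. -/
noncomputable def VLSFScheme.jointLaw (c : VLSFScheme U X Y n k) (W : Kernel X Y)
    [IsMarkovKernel W] : Measure (CodeSpace U Y k) :=
  ((c.commonLaw.prod (PMF.uniformOfFintype (Fin (2 ^ k))).toMeasure) ⊗ₘ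
    ((memorylessOutput W).comap c.encoder c.measurable_encoder)).map
      MeasurableEquiv.prodAssoc

/-- The final estimate of the message. -/
def VLSFScheme.estimate (c : VLSFScheme U X Y n k) (ω : CodeSpace U Y k) : Fin (2 ^ k) :=
  c.decoder (c.tau ω) (receiverView n k (c.tau ω) ω)

end

/-- An `(n, k, Pτ, ε)`-VLSF code over the channel `W`: the stopping time has law `Pτ` and the
probability that the final estimate differs from the message is at most `ε`. -/
structure VLSFCode (U : Type*) {X Y : Type*} [MeasurableSpace U] [MeasurableSpace X]
    [MeasurableSpace Y] (W : Kernel X Y) [IsMarkovKernel W] (n k : ℕ) (Pτ : Measure ℕ) (ε : ℝ)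
    extends VLSFScheme U X Y n k where
  tau_law : (toVLSFScheme.jointLaw W).map tau = Pτ
  error_le : (toVLSFScheme.jointLaw W) {ω | toVLSFScheme.estimate ω ≠ ω.2.1} ≤ ENNReal.ofReal ε

/-! ### The frame-asynchronous queue -/

/-- Inputs of the frame-asynchronous single-server queue on the probability space `(Ω, P)`.
Channel uses and packets are numbered `1, 2, 3, …` (the index `0` plays no role).
In each channel use a packet arrives with probability `lam`, independently across channel uses;
the numbers of frames used by the packets are i.i.d. with law `Pτ` and independent of the
arrivals. -/
structure FrameAsyncQueue {Ω : Type*} [MeasurableSpace Ω] (P : Measure Ω) (lam : ℝ)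
    (Pτ : Measure ℕ) where
  /-- does a packet arrive in channel use `t`? -/
  arrival : ℕ → Ω → Bool
  /-- number of frames used by the `m`-th packet -/
  frames : ℕ → Ω → ℕ
  measurable_arrival : ∀ t, Measurable (arrival t)
  measurable_frames : ∀ m, Measurable (frames m)
  arrival_law : ∀ t, P {ω | arrival t ω = true} = ENNReal.ofReal lam
  frames_law : ∀ m, P.map (frames m) = Pτ
  indep_arrival : iIndepFun arrival P
  indep_frames : iIndepFun frames P
  indep_arrival_frames : IndepFun (fun ω t => arrival t ω) (fun ω m => frames m ω) P

section
variable {Ω : Type*} [MeasurableSpace Ω] {P : Measure Ω} {lam : ℝ} {Pτ : Measure ℕ}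

/-- Channel use in which the `m`-th packet arrives: the first `u ≥ 1` such that `m` packets have
arrived in the channel uses `1, …, u`. -/
noncomputable def FrameAsyncQueue.arrivalTime (Q : FrameAsyncQueue P lam Pτ) (m : ℕ) (ω : Ω) : ℕ :=
  sInf {u : ℕ | 0 < u ∧ ∑ t ∈ Finset.Icc 1 u, (if Q.arrival t ω then 1 else 0) = m}

/-- Last channel use of the transmission of the `m`-th packet, under first-come first-served
service with frames of `n` channel uses. The transmission starts in the channel use that follows
the later of the arrival of the packet and the departure of the previous packet; it takes
`n * frames m` channel uses. -/
noncomputable def FrameAsyncQueue.departureTime (Q : FrameAsyncQueue P lam Pτ) (n : ℕ) :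
    ℕ → Ω → ℕ
  | 0, _ => 0
  | m + 1, ω => max (Q.arrivalTime (m + 1) ω) (Q.departureTime n m ω) + n * Q.frames (m + 1) ω

/-- Delay (waiting time plus service time) of the `m`-th packet in channel uses. The departure
never precedes the arrival when `m ≥ 1`. -/
noncomputable def FrameAsyncQueue.delay (Q : FrameAsyncQueue P lam Pτ) (n m : ℕ) (ω : Ω) : ℕ :=
  Q.departureTime n m ω - Q.arrivalTime m ω

end

/-- `π` is the steady-state distribution of the process `D`: it is a probability distribution and
the law of `D m` converges to it as `m → ∞`. -/
def IsSteadyStateLaw {Ω : Type*} [MeasurableSpace Ω] (P : Measure Ω) (D : ℕ → Ω → ℕ)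
    (π : Measure ℕ) : Prop :=
  IsProbabilityMeasure π ∧
    ∀ d : ℕ, Tendsto (fun m => P {ω | D m ω = d}) atTop (𝓝 (π {d}))

/-- Probability generating function `E[s ^ X]` of a random variable `X` with law `μ` on `ℕ`. -/
noncomputable def pgf (μ : Measure ℕ) (s : ℂ) : ℂ := ∫ d, s ^ d ∂μ

/-- Expectation of a random variable with law `μ` on `ℕ` (meaningful if it is integrable). -/
noncomputable def meanOf (μ : Measure ℕ) : ℝ := ∫ d, (d : ℝ) ∂μ

/-! The delays obey a Lindley recursion `D' = (D - T)⁺ + n * S`, where the geometric gap `T ≥ 1` to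
the next arrival and the frame number `S` of the next packet are independent of `D` and of each
other. This map is monotone in `D`, so from an empty system the laws increase stochastically and
their point masses converge to those of a measure `π` of mass at most one. The issue is that mass
might escape to infinity.

Put `q = 1 - p`, `ρ = p * n * E[τ]` and `c = E[q ^ D]`, the probability that `T > D`. One step acts
on generating functions by `(s - q) G'(s) = (p G(s) + (s - 1) c) G_τ(s ^ n)`
(`integral_pow_waitStep`, `integral_pow_delayStep`). Along the sequence `G' ≤ G` on `[0, 1]`;
dividing by `1 - s` and letting `s ↑ 1` gives `c ≥ 1 - ρ` for every law, hence in the limit. The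
same passage in the limiting identity, where `G' = G`, gives `c = π(ℕ) (1 - ρ)`. As `ρ < 1`, the
mass of `π` is one and `c = 1 - ρ`. A Fatou argument makes `π` stationary, and the stationary
identity solved for `G` is the formula.

On the queue side, an event fixing the arrival time and the delay of a packet involves only inputs
up to that time, while the next gap and frame number involve later ones. This yields the
independence in the recursion (`measure_delay_gap_frames`). -/

/-! ### One step of the Lindley recursion on laws -/

/-- Law of `(D - T)⁺` when `D` has law `μ` and `T ≥ 1` is an independent geometric time. -/
noncomputable def waitStep (p : unitInterval) (μ : Measure ℕ) : Measure ℕ :=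
  (μ.prod (geometricMeasure p)).map fun z => z.1 - (z.2 + 1)

/-- Law of `(D - T)⁺ + n * S` when `D`, `T`, `S` are independent with laws `μ`, geometric and
`τ`. -/
noncomputable def delayStep (p : unitInterval) (n : ℕ) (τ μ : Measure ℕ) : Measure ℕ :=
  ((waitStep p μ).prod τ).map fun z => z.1 + n * z.2

section
variable {p : unitInterval} {n : ℕ} {τ μ ν : Measure ℕ}

instance [IsProbabilityMeasure μ] : IsProbabilityMeasure (waitStep p μ) :=
  Measure.isProbabilityMeasure_map (Measurable.of_discrete.aemeasurable)

instance [IsProbabilityMeasure μ] [IsProbabilityMeasure τ] :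
    IsProbabilityMeasure (delayStep p n τ μ) :=
  Measure.isProbabilityMeasure_map (Measurable.of_discrete.aemeasurable)

lemma lintegral_waitStep [SFinite μ] (h : ℕ → ENNReal) :
    ∫⁻ w, h w ∂(waitStep p μ) = ∫⁻ d, ∫⁻ g, h (d - (g + 1)) ∂(geometricMeasure p) ∂μ := by
  rw [waitStep, lintegral_map .of_discrete .of_discrete, lintegral_prod _ (by fun_prop)]

lemma lintegral_delayStep [IsProbabilityMeasure μ] [SFinite τ] (h : ℕ → ENNReal) :
    ∫⁻ d, h d ∂(delayStep p n τ μ) =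
      ∫⁻ d, ∫⁻ g, ∫⁻ k, h (d - (g + 1) + n * k) ∂τ ∂(geometricMeasure p) ∂μ := by
  rw [delayStep, lintegral_map .of_discrete .of_discrete, lintegral_prod _ (by fun_prop),
    lintegral_waitStep]

/-- Stochastic order of laws on `ℕ`. -/
def StochLE (μ ν : Measure ℕ) : Prop :=
  ∀ h : ℕ → ENNReal, Antitone h → ∫⁻ d, h d ∂ν ≤ ∫⁻ d, h d ∂μ

/-- For fixed `g` and `k` the map `d ↦ d - (g + 1) + n * k` is monotone, so an antitone test
function pulls back to an antitone one. -/
lemma StochLE.delayStep [IsProbabilityMeasure μ] [IsProbabilityMeasure ν] [SFinite τ]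
    (h : StochLE μ ν) : StochLE (delayStep p n τ μ) (delayStep p n τ ν) := by
  intro f hf
  rw [lintegral_delayStep, lintegral_delayStep]
  refine h _ fun a b hab => ?_
  refine lintegral_mono fun g => lintegral_mono fun k => hf ?_
  omega

lemma stochLE_dirac_zero [IsProbabilityMeasure μ] : StochLE (Measure.dirac 0) μ := by
  intro f hf
  rw [lintegral_dirac]
  calc ∫⁻ d, f d ∂μ ≤ ∫⁻ _, f 0 ∂μ := lintegral_mono fun d => hf (Nat.zero_le d)
    _ = f 0 := by simp

lemma StochLE.measureReal_Iic_le [IsProbabilityMeasure μ] [IsProbabilityMeasure ν]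
    (h : StochLE μ ν) (d : ℕ) : ν.real (Set.Iic d) ≤ μ.real (Set.Iic d) := by
  have := h (Set.indicator (Set.Iic d) 1) (by
    intro a b hab
    by_cases hb : b ≤ d
    · simp [Set.indicator, hb, hab.trans hb]
    · simp [Set.indicator, hb])
  rw [lintegral_indicator_one measurableSet_Iic, lintegral_indicator_one measurableSet_Iic] at this
  exact ENNReal.toReal_mono (measure_ne_top _ _) this

lemma integrable_pow_of_norm_le_one {𝕜 : Type*} [RCLike 𝕜] [IsFiniteMeasure μ] {s : 𝕜}
    (hs : ‖s‖ ≤ 1) : Integrable (fun d : ℕ => s ^ d) μ :=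
  Integrable.of_bound (Measurable.of_discrete.aestronglyMeasurable) 1 <| .of_forall fun d => by
    rw [norm_pow]; exact pow_le_one₀ (norm_nonneg _) hs

lemma StochLE.integral_pow_le [IsProbabilityMeasure μ] [IsProbabilityMeasure ν]
    (h : StochLE μ ν) {s : ℝ} (h0 : 0 ≤ s) (h1 : s ≤ 1) :
    ∫ d, s ^ d ∂ν ≤ ∫ d, s ^ d ∂μ := by
  rw [integral_eq_lintegral_of_nonneg_ae (.of_forall fun d => pow_nonneg h0 d)
      Measurable.of_discrete.aestronglyMeasurable,
    integral_eq_lintegral_of_nonneg_ae (.of_forall fun d => pow_nonneg h0 d)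
      Measurable.of_discrete.aestronglyMeasurable]
  refine ENNReal.toReal_mono ?_ (h _ fun a b hab =>
    ENNReal.ofReal_le_ofReal (pow_le_pow_of_le_one h0 h1 hab))
  have hi : Integrable (fun d : ℕ => s ^ d) μ :=
    integrable_pow_of_norm_le_one (by rwa [Real.norm_of_nonneg h0])
  exact ((hasFiniteIntegral_iff_ofReal (.of_forall fun d => pow_nonneg h0 d)).1
    hi.hasFiniteIntegral).ne

/-! ### Generating functions under one step -/

/-- Conditioning a geometric number of failures on the first trial. -/
lemma integral_geometricMeasure_succ {𝕜 : Type*} [RCLike 𝕜] (hp : p ≠ 0) {h : ℕ → 𝕜}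
    (hh : Integrable h (geometricMeasure p)) :
    ∫ g, h g ∂(geometricMeasure p) =
      (p : ℝ) • h 0 + (1 - p : ℝ) • ∫ g, h (g + 1) ∂(geometricMeasure p) := by
  rw [integral_geometricMeasure hp h, integral_geometricMeasure hp fun g => h (g + 1),
    (hasSum_integral_geometricMeasure hp hh).summable.tsum_eq_zero_add, ← tsum_const_smul'']
  simp only [pow_zero, one_mul, smul_smul]
  congr 2
  funext g
  ring_nf

lemma integrable_pow_sub_geometric {𝕜 : Type*} [RCLike 𝕜] (s : 𝕜) (d : ℕ) :
    Integrable (fun g : ℕ => s ^ (d - (g + 1))) (geometricMeasure p) := by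
  refine Integrable.of_bound (Measurable.of_discrete.aestronglyMeasurable) (‖s‖ ^ d + 1)
    (.of_forall fun g => ?_)
  rw [norm_pow]
  rcases le_total ‖s‖ 1 with h | h
  · have := pow_le_one₀ (n := d - (g + 1)) (norm_nonneg s) h
    have := pow_nonneg (norm_nonneg s) d
    linarith
  · have := pow_le_pow_right₀ h (Nat.sub_le d (g + 1))
    linarith

/-- Induction on `d` through the first trial: success leaves `s ^ d`, failure leaves the same
problem with `d` in place of `d + 1`. Keeping the factor `s - (1 - p)` on the left avoids excluding
its zero. -/
lemma integral_pow_sub_geometric {𝕜 : Type*} [RCLike 𝕜] (hp : p ≠ 0) (s : 𝕜) (d : ℕ) :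
    (s - ((1 - p : ℝ) : 𝕜)) * ∫ g, s ^ (d - (g + 1)) ∂(geometricMeasure p) =
      ((p : ℝ) : 𝕜) * s ^ d + (s - 1) * ((1 - p : ℝ) : 𝕜) ^ d := by
  induction d with
  | zero => simp; ring
  | succ d ih =>
    rw [integral_geometricMeasure_succ hp (integrable_pow_sub_geometric s _)]
    simp only [RCLike.real_smul_eq_coe_mul, zero_add, Nat.add_sub_cancel, Nat.add_sub_add_right]
    rw [mul_add, mul_left_comm _ (((1 - p : ℝ)) : 𝕜), ih]
    push_cast
    ring

lemma integral_pow_waitStep {𝕜 : Type*} [RCLike 𝕜] [IsProbabilityMeasure μ] (hp : p ≠ 0) {s : 𝕜}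
    (hs : Integrable (fun d : ℕ => s ^ d) μ) :
    (s - ((1 - p : ℝ) : 𝕜)) * ∫ w, s ^ w ∂(waitStep p μ) =
      ((p : ℝ) : 𝕜) * (∫ d, s ^ d ∂μ) + (s - 1) * ∫ d, ((1 - p : ℝ) : 𝕜) ^ d ∂μ := by
  have hi : Integrable (fun z : ℕ × ℕ => s ^ (z.1 - (z.2 + 1))) (μ.prod (geometricMeasure p)) := by
    have h1 : Integrable (fun z : ℕ × ℕ => ‖s ^ z.1‖ + 1) (μ.prod (geometricMeasure p)) :=
      (hs.norm.comp_fst (geometricMeasure p)).add (integrable_const 1)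
    refine h1.mono' (Measurable.of_discrete.aestronglyMeasurable) (.of_forall fun z => ?_)
    rw [norm_pow, norm_pow]
    rcases le_total ‖s‖ 1 with h | h
    · have := pow_le_one₀ (n := z.1 - (z.2 + 1)) (norm_nonneg s) h
      have := pow_nonneg (norm_nonneg s) z.1
      linarith
    · have := pow_le_pow_right₀ h (Nat.sub_le z.1 (z.2 + 1))
      linarith
  have hq : Integrable (fun d : ℕ => ((1 - p : ℝ) : 𝕜) ^ d) μ := by
    apply integrable_pow_of_norm_le_one
    rw [RCLike.norm_ofReal, abs_le]
    have h0 := p.2.1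
    have h1 := p.2.2
    constructor <;> linarith
  rw [waitStep, integral_map Measurable.of_discrete.aemeasurable
    Measurable.of_discrete.aestronglyMeasurable, integral_prod _ hi, ← integral_const_mul,
    ← integral_const_mul, ← integral_const_mul, ← integral_add (hs.const_mul _) (hq.const_mul _)]
  exact integral_congr_ae (.of_forall fun d => integral_pow_sub_geometric hp s d)

/-- The two summands are independent. No integrability is required, because the product formula also
holds with the default value `0` of a divergent integral. -/
lemma integral_pow_delayStep {𝕜 : Type*} [RCLike 𝕜] [IsProbabilityMeasure μ] [SFinite τ]
    (s : 𝕜) :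
    ∫ d, s ^ d ∂(delayStep p n τ μ) = (∫ w, s ^ w ∂(waitStep p μ)) * ∫ k, (s ^ n) ^ k ∂τ := by
  rw [delayStep, integral_map Measurable.of_discrete.aemeasurable
    Measurable.of_discrete.aestronglyMeasurable, ← integral_prod_mul]
  simp only [pow_add, pow_mul]

end

/-! ### The stationary law -/

/-- Laws whose distribution functions decrease converge pointwise to a sub-probability measure. -/
lemma exists_tendsto_of_stochLE_succ (μ : ℕ → Measure ℕ) [∀ m, IsProbabilityMeasure (μ m)]
    (hμ : ∀ m, StochLE (μ m) (μ (m + 1))) :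
    ∃ π : Measure ℕ, π Set.univ ≤ 1 ∧
      ∀ d, Tendsto (fun m => μ m {d}) atTop (𝓝 (π {d})) := by
  have hF : ∀ d, ∃ x, Tendsto (fun m => (μ m).real (Set.Iic d)) atTop (𝓝 x) := fun d =>
    ⟨_, tendsto_atTop_ciInf (antitone_nat_of_succ_le fun m => (hμ m).measureReal_Iic_le d)
      ⟨0, by rintro _ ⟨m, rfl⟩; exact measureReal_nonneg⟩⟩
  choose F hF using hF
  have hp : ∀ d, ∃ x, Tendsto (fun m => (μ m).real {d}) atTop (𝓝 x) := by
    intro d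
    cases d with
    | zero =>
      refine ⟨F 0, (hF 0).congr fun m => ?_⟩
      congr 1
      ext; simp
    | succ d =>
      refine ⟨F (d + 1) - F d, ((hF (d + 1)).sub (hF d)).congr fun m => ?_⟩
      have : Set.Iic (d + 1) = Set.Iic d ∪ {d + 1} := by
        ext; simp; omega
      rw [this, measureReal_union (by simp) (measurableSet_singleton _)]
      ring
  choose x hx using hp
  have hx0 : ∀ d, 0 ≤ x d := fun d => ge_of_tendsto' (hx d) fun m => measureReal_nonneg
  have hπ : ∀ d, (Measure.sum fun d => ENNReal.ofReal (x d) • Measure.dirac d) {d} =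
      ENNReal.ofReal (x d) := fun d => Measure.sum_smul_dirac_singleton
  have hlim : ∀ d, Tendsto (fun m => μ m {d}) atTop (𝓝 (ENNReal.ofReal (x d))) := fun d => by
    refine (ENNReal.tendsto_ofReal (hx d)).congr fun m => ?_
    simp
  refine ⟨Measure.sum fun d => ENNReal.ofReal (x d) • Measure.dirac d, ?_, fun d => ?_⟩
  · rw [← lintegral_one, lintegral_countable']
    refine ENNReal.tsum_le_of_sum_range_le fun N => ?_
    simp only [hπ, one_mul]
    -- Only finite partial sums pass to the limit, so the total mass is bounded by one but may still
    -- drop.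
    refine le_of_tendsto' (tendsto_finsetSum _ fun d _ => hlim d) fun m => ?_
    rw [sum_measure_singleton]
    exact prob_le_one
  · rw [hπ]
    exact hlim d

/-- For `s < 1` the summable bound `s ^ d` makes any mass escaping to infinity invisible; this is
why `s = 1` is excluded. -/
lemma tendsto_integral_pow_of_tendsto_singleton {μ : ℕ → Measure ℕ} {π : Measure ℕ}
    [∀ m, IsProbabilityMeasure (μ m)] [IsFiniteMeasure π]
    (h : ∀ d, Tendsto (fun m => μ m {d}) atTop (𝓝 (π {d}))) {s : ℝ} (h0 : 0 ≤ s) (h1 : s < 1) :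
    Tendsto (fun m => ∫ d, s ^ d ∂(μ m)) atTop (𝓝 (∫ d, s ^ d ∂π)) := by
  have hs : ‖s‖ ≤ 1 := by rw [Real.norm_of_nonneg h0]; exact h1.le
  simp_rw [fun m => integral_countable (integrable_pow_of_norm_le_one (μ := μ m) hs),
    integral_countable (integrable_pow_of_norm_le_one (μ := π) hs)]
  refine tendsto_tsum_of_dominated_convergence (summable_geometric_of_lt_one h0 h1)
    (fun d => ?_) (.of_forall fun m d => ?_)
  · exact ((ENNReal.tendsto_toReal (measure_ne_top π _)).comp (h d)).smul_const _
  · rw [smul_eq_mul, norm_mul, Real.norm_of_nonneg measureReal_nonneg,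
      Real.norm_of_nonneg (pow_nonneg h0 d)]
    exact mul_le_of_le_one_left (pow_nonneg h0 d) measureReal_le_one

lemma delayStep_singleton_eq_tsum {p : unitInterval} {n : ℕ} {τ μ : Measure ℕ}
    [IsProbabilityMeasure μ] [IsProbabilityMeasure τ] (d : ℕ) :
    delayStep p n τ μ {d} = ∑' a, (∫⁻ g, ∫⁻ k, Set.indicator {d} 1 (a - (g + 1) + n * k) ∂τ
      ∂(geometricMeasure p)) * μ {a} := by
  rw [← lintegral_indicator_one (measurableSet_singleton d), lintegral_delayStep,
    lintegral_countable']

/-- Fatou for sums: the limit of finite partial sums gives `delayStep p n τ π ≤ π`, and an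
inequality between two probability measures is an equality. -/
lemma delayStep_eq_of_tendsto {p : unitInterval} {n : ℕ} {τ π : Measure ℕ} {μ : ℕ → Measure ℕ}
    [∀ m, IsProbabilityMeasure (μ m)] [IsProbabilityMeasure τ] [IsProbabilityMeasure π]
    (hμ : ∀ m, μ (m + 1) = delayStep p n τ (μ m))
    (h : ∀ d, Tendsto (fun m => μ m {d}) atTop (𝓝 (π {d}))) :
    delayStep p n τ π = π := by
  refine Measure.eq_of_le_of_isProbabilityMeasure (Measure.le_iff.2 fun S _ => ?_)
  rw [← lintegral_indicator_one (MeasurableSet.of_discrete (s := S)),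
    ← lintegral_indicator_one (MeasurableSet.of_discrete (s := S)), lintegral_countable',
    lintegral_countable']
  refine ENNReal.tsum_le_tsum fun d => mul_le_mul_right ?_ _
  rw [delayStep_singleton_eq_tsum]
  refine ENNReal.tsum_le_of_sum_range_le fun N => ?_
  refine le_of_tendsto_of_tendsto' (tendsto_finsetSum _ fun a _ =>
    ENNReal.Tendsto.const_mul (h a) (.inr ?_)) ((h d).comp (tendsto_add_atTop_nat 1)) fun m => ?_
  · refine ne_top_of_le_ne_top ENNReal.one_ne_top ?_
    calc _ ≤ ∫⁻ _, ∫⁻ _, 1 ∂τ ∂(geometricMeasure p) :=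
          lintegral_mono fun g => lintegral_mono fun k =>
            Set.indicator_le_self' (fun _ _ => zero_le_one) _
      _ = 1 := by simp
  · rw [Function.comp_apply, hμ, delayStep_singleton_eq_tsum]
    exact ENNReal.sum_le_tsum _

/-! ### Generating functions near `s = 1` -/

/-- Bernoulli's inequality `1 - n * k * (1 - s) ≤ s ^ (n * k)`, integrated over `k`. -/
lemma one_sub_integral_pow_le {n : ℕ} {τ : Measure ℕ} [IsProbabilityMeasure τ]
    (hmean : Integrable (fun t : ℕ => (t : ℝ)) τ) {s : ℝ} (h0 : 0 ≤ s) (h1 : s ≤ 1) :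
    1 - ∫ k, (s ^ n) ^ k ∂τ ≤ (1 - s) * (n * meanOf τ) := by
  have hs : Integrable (fun k : ℕ => (s ^ n) ^ k) τ := integrable_pow_of_norm_le_one (by
    rw [Real.norm_of_nonneg (pow_nonneg h0 n)]; exact pow_le_one₀ h0 h1)
  have : ∫ k : ℕ, (1 - (1 - s) * (n * (k : ℝ))) ∂τ ≤ ∫ k, (s ^ n) ^ k ∂τ := by
    refine integral_mono ((integrable_const 1).sub ((hmean.const_mul _).const_mul _)) hs fun k => ?_
    have := one_add_mul_le_pow (a := s - 1) (by linarith) (n * k)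
    dsimp only
    rw [← pow_mul]
    push_cast at this
    simp only [add_sub_cancel] at this
    linarith
  rw [integral_sub (integrable_const 1) ((hmean.const_mul _).const_mul _), integral_const_mul,
    integral_const_mul] at this
  simp only [integral_const, probReal_univ, one_smul] at this
  rw [meanOf]
  linarith

/-- Each difference quotient tends to the derivative `n * k` of `s ^ (n * k)` at `1`; Bernoulli's
inequality makes `n * k` a dominating function as well. -/
lemma tendsto_one_sub_integral_pow_div {n : ℕ} {τ : Measure ℕ} [IsProbabilityMeasure τ]
    (hmean : Integrable (fun t : ℕ => (t : ℝ)) τ) :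
    Tendsto (fun s : ℝ => (1 - ∫ k, (s ^ n) ^ k ∂τ) / (1 - s)) (𝓝[<] 1) (𝓝 (n * meanOf τ)) := by
  have hev : ∀ᶠ s : ℝ in 𝓝[<] 1, s ∈ Set.Ioo (0 : ℝ) 1 := Ioo_mem_nhdsLT one_pos
  have key : Tendsto (fun s : ℝ => ∫ k : ℕ, (1 - (s ^ n) ^ k) / (1 - s) ∂τ) (𝓝[<] 1)
      (𝓝 (∫ k : ℕ, (n * k : ℝ) ∂τ)) := by
    refine tendsto_integral_filter_of_dominated_convergence (fun k : ℕ => (n * k : ℝ))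
      (.of_forall fun s => Measurable.of_discrete.aestronglyMeasurable) ?_
      (hmean.const_mul _) (.of_forall fun k => ?_)
    · filter_upwards [hev] with s hs
      refine .of_forall fun k => ?_
      have h1 : 0 < 1 - s := by linarith [hs.2]
      have h2 : (s ^ n) ^ k ≤ 1 := pow_le_one₀ (pow_nonneg hs.1.le n) (pow_le_one₀ hs.1.le hs.2.le)
      have := one_add_mul_le_pow (a := s - 1) (by linarith [hs.1]) (n * k)
      rw [Real.norm_of_nonneg (div_nonneg (by linarith) h1.le), div_le_iff₀ h1, ← pow_mul]
      push_cast at this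
      simp only [add_sub_cancel] at this
      linarith
    · have := (hasDerivAt_pow (n * k) (1 : ℝ)).tendsto_slope.mono_left
        (nhdsWithin_mono 1 fun s (hs : s < 1) => hs.ne)
      simp only [one_pow, mul_one] at this
      push_cast at this
      refine this.congr fun s => ?_
      rw [slope_def_field, one_pow, ← pow_mul, ← neg_div_neg_eq, neg_sub, neg_sub]
  rw [integral_const_mul] at key
  refine key.congr' ?_
  filter_upwards [hev] with s hs
  have hi : Integrable (fun k : ℕ => (s ^ n) ^ k) τ := integrable_pow_of_norm_le_one (by
    rw [Real.norm_of_nonneg (pow_nonneg hs.1.le n)]; exact pow_le_one₀ hs.1.le hs.2.le)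
  rw [integral_div, integral_sub (integrable_const 1) hi]
  simp

lemma tendsto_integral_pow_one (n : ℕ) (μ : Measure ℕ) [IsFiniteMeasure μ] :
    Tendsto (fun s : ℝ => ∫ k, (s ^ n) ^ k ∂μ) (𝓝[<] 1) (𝓝 (μ.real Set.univ)) := by
  have key : Tendsto (fun s : ℝ => ∫ k, (s ^ n) ^ k ∂μ) (𝓝[<] 1) (𝓝 (∫ k : ℕ, (1 : ℝ) ∂μ)) := by
    refine tendsto_integral_filter_of_dominated_convergence (fun _ => (1 : ℝ))
      (.of_forall fun s => Measurable.of_discrete.aestronglyMeasurable) ?_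
      (integrable_const 1) (.of_forall fun k => ?_)
    · filter_upwards [Ioo_mem_nhdsLT (one_pos : (0 : ℝ) < 1)] with s hs
      refine .of_forall fun k => ?_
      rw [norm_pow, norm_pow, Real.norm_of_nonneg hs.1.le]
      exact pow_le_one₀ (pow_nonneg hs.1.le n) (pow_le_one₀ hs.1.le hs.2.le)
    · have : Continuous fun s : ℝ => (s ^ n) ^ k := by fun_prop
      simpa using (this.tendsto 1).mono_left nhdsWithin_le_nhds
  simpa using key

/-- Existence of a stationary law for the Lindley recursion started from an empty system. -/
theorem exists_stationary_delayStep {p : unitInterval} (hp : p ≠ 0) {n : ℕ} {τ : Measure ℕ}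
    [IsProbabilityMeasure τ] (hmean : Integrable (fun t : ℕ => (t : ℝ)) τ)
    (hstable : (p : ℝ) * n * meanOf τ < 1) (μ : ℕ → Measure ℕ) (hμ0 : μ 0 = Measure.dirac 0)
    (hμ : ∀ m, μ (m + 1) = delayStep p n τ (μ m)) :
    ∃ π : Measure ℕ, IsProbabilityMeasure π ∧
      (∀ d, Tendsto (fun m => μ m {d}) atTop (𝓝 (π {d}))) ∧ delayStep p n τ π = π ∧
      ∫ d, (1 - p : ℝ) ^ d ∂π = 1 - (p : ℝ) * n * meanOf τ := by
  have hp0 : (0 : ℝ) < p := lt_of_le_of_ne p.2.1 fun h => hp (Subtype.ext h.symm)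
  have hq0 : (0 : ℝ) ≤ 1 - p := by linarith [p.2.2]
  have hprob : ∀ m, IsProbabilityMeasure (μ m) := by
    intro m
    induction m with
    | zero => rw [hμ0]; infer_instance
    | succ m ih => rw [hμ]; infer_instance
  have hmono : ∀ m, StochLE (μ m) (μ (m + 1)) := by
    intro m
    induction m with
    | zero => rw [hμ0]; exact stochLE_dirac_zero
    | succ m ih => rw [hμ (m + 1)]; nth_rw 1 [hμ m]; exact ih.delayStep
  obtain ⟨π, hπ1, hlim⟩ := exists_tendsto_of_stochLE_succ μ hmono
  have : IsFiniteMeasure π := ⟨hπ1.trans_lt ENNReal.one_lt_top⟩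
  have hπ1' : π.real Set.univ ≤ 1 := ENNReal.toReal_le_of_le_ofReal zero_le_one (by simpa using hπ1)
  set c : ℕ → ℝ := fun m => ∫ d, (1 - p : ℝ) ^ d ∂(μ m) with hc
  set S : ℝ → ℝ := fun s => ∫ k, (s ^ n) ^ k ∂τ with hS
  have hclim : Tendsto c atTop (𝓝 (∫ d, (1 - p : ℝ) ^ d ∂π)) :=
    tendsto_integral_pow_of_tendsto_singleton hlim hq0 (by linarith)
  set c' : ℝ := ∫ d, (1 - p : ℝ) ^ d ∂π with hc'
  have hrec : ∀ m (s : ℝ), s ∈ Set.Ioo (0 : ℝ) 1 → (s - (1 - p)) * ∫ d, s ^ d ∂(μ (m + 1)) =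
      (p * ∫ d, s ^ d ∂(μ m) + (s - 1) * c m) * S s := by
    intro m s hs
    have h1 := integral_pow_waitStep (μ := μ m) hp (s := s)
      (integrable_pow_of_norm_le_one (by rw [Real.norm_of_nonneg hs.1.le]; exact hs.2.le))
    simp only [RCLike.ofReal_real_eq_id, id_eq] at h1
    rw [hμ, integral_pow_delayStep, ← mul_assoc, h1]
  have hrec' : ∀ s : ℝ, s ∈ Set.Ioo (0 : ℝ) 1 → (s - (1 - p)) * ∫ d, s ^ d ∂π =
      (p * ∫ d, s ^ d ∂π + (s - 1) * c') * S s := by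
    intro s hs
    have hG := tendsto_integral_pow_of_tendsto_singleton hlim hs.1.le hs.2
    exact tendsto_nhds_unique_of_eventuallyEq
      ((hG.comp (tendsto_add_atTop_nat 1)).const_mul (s - (1 - p : ℝ)))
      (((hG.const_mul (p : ℝ)).add (hclim.const_mul (s - 1))).mul_const (S s))
      (.of_forall fun m => hrec m s hs)
  have hone : ∀ (ν : Measure ℕ) [IsFiniteMeasure ν],
      Tendsto (fun s : ℝ => ∫ k, s ^ k ∂ν) (𝓝[<] 1) (𝓝 (ν.real Set.univ)) := fun ν _ => by
    simpa using tendsto_integral_pow_one 1 ν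
  have hS1 : Tendsto S (𝓝[<] 1) (𝓝 1) := by simpa using tendsto_integral_pow_one n τ
  -- Inserting `G (m + 1) ≤ G m` into `hrec` gives `G m * (1 - s - p * (1 - S s)) ≤ (1 - s) * c m *
  -- S s`. Bound `1 - S s` by Bernoulli, cancel `1 - s` and let `s ↑ 1`.
  have hcge : ∀ m, 1 - (p : ℝ) * n * meanOf τ ≤ c m := by
    intro m
    have hl : Tendsto (fun s : ℝ => (∫ d, s ^ d ∂(μ m)) * (1 - (p : ℝ) * n * meanOf τ)) (𝓝[<] 1)
        (𝓝 (1 - (p : ℝ) * n * meanOf τ)) := by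
      simpa using (hone (μ m)).mul_const (1 - (p : ℝ) * n * meanOf τ)
    have hr : Tendsto (fun s => c m * S s) (𝓝[<] 1) (𝓝 (c m)) := by
      simpa using hS1.const_mul (c m)
    refine le_of_tendsto_of_tendsto hl hr ?_
    -- Taking `s > 1 - p` makes the factor `s - (1 - p)` nonnegative, so that it preserves the
    -- inequality.
    have hlt : max 0 (1 - p : ℝ) < 1 := max_lt one_pos (by linarith)
    filter_upwards [Ioo_mem_nhdsLT hlt] with s hs
    have hs0 : 0 < s := (le_max_left _ _).trans_lt hs.1
    have hsq : 1 - (p : ℝ) < s := (le_max_right _ _).trans_lt hs.1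
    have h1 := (hmono m).integral_pow_le hs0.le hs.2.le
    have h2 := hrec m s ⟨hs0, hs.2⟩
    have h3 : 1 - S s ≤ _ := one_sub_integral_pow_le hmean hs0.le hs.2.le
    have hG0 : 0 ≤ ∫ d, s ^ d ∂(μ m) := integral_nonneg fun d => pow_nonneg hs0.le d
    have h4 := mul_le_mul_of_nonneg_left h1 (sub_nonneg.2 hsq.le)
    have h5 := mul_le_mul_of_nonneg_left h3 (mul_nonneg hp0.le hG0)
    refine le_of_mul_le_mul_left ?_ (sub_pos.2 hs.2)
    linarith
  have hc'ge : 1 - (p : ℝ) * n * meanOf τ ≤ c' := ge_of_tendsto' hclim hcge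
  -- Here the identity `hrec'` is exact, so division by `1 - s` yields an equality that carries the
  -- unknown mass of `π`.
  have heq : π.real Set.univ * (1 - p * (n * meanOf τ)) = c' := by
    have hl := (hone π).mul (((tendsto_one_sub_integral_pow_div (n := n) hmean).const_mul
      (p : ℝ)).const_sub 1)
    have hr : Tendsto (fun s => c' * S s) (𝓝[<] 1) (𝓝 c') := by
      simpa using hS1.const_mul c'
    refine tendsto_nhds_unique_of_eventuallyEq hl hr ?_
    filter_upwards [Ioo_mem_nhdsLT (one_pos : (0 : ℝ) < 1)] with s hs
    have h2 := hrec' s hs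
    have h3 : 1 - s ≠ 0 := by linarith [hs.2]
    change _ * (1 - p * ((1 - S s) / (1 - s))) = _
    field_simp
    linarith
  have hpos : 0 < 1 - (p : ℝ) * n * meanOf τ := by linarith
  -- No mass escapes: `π(ℕ) * (1 - ρ) = c' ≥ 1 - ρ`, and `1 - ρ > 0` by stability.
  have huniv : π.real Set.univ = 1 := by
    refine le_antisymm hπ1' (le_of_mul_le_mul_right ?_ hpos)
    rw [← mul_assoc] at heq
    linarith
  have hπp : IsProbabilityMeasure π := ⟨by
    rw [← ENNReal.toReal_eq_one_iff]; exact huniv⟩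
  refine ⟨π, hπp, hlim, delayStep_eq_of_tendsto hμ hlim, ?_⟩
  rw [huniv] at heq
  linarith

/-! ### Counting arrivals -/

/-- Number of arrivals in the channel uses `1, …, u`. -/
def arrivalCount (x : ℕ → Bool) (u : ℕ) : ℕ :=
  ∑ t ∈ Finset.Icc 1 u, if x t then 1 else 0

/-- Channel use of the `m`-th arrival. -/
noncomputable def nthArrival (x : ℕ → Bool) (m : ℕ) : ℕ :=
  sInf {u : ℕ | 0 < u ∧ arrivalCount x u = m}

section
variable {x : ℕ → Bool}

@[simp] lemma arrivalCount_zero : arrivalCount x 0 = 0 := rfl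

lemma arrivalCount_succ (u : ℕ) :
    arrivalCount x (u + 1) = arrivalCount x u + if x (u + 1) then 1 else 0 :=
  Finset.sum_Icc_succ_top (by omega) _

lemma arrivalCount_mono : Monotone (arrivalCount x) :=
  monotone_nat_of_le_succ fun u => by rw [arrivalCount_succ]; omega

/-- The value is written `b + 1` because `sInf ∅ = 0`: a positive value certifies that the arrival
occurs. The right side involves only channel uses up to `b + 1`, which makes arrival times stopping
times. -/
lemma nthArrival_succ_eq_succ_iff {m b : ℕ} :
    nthArrival x (m + 1) = b + 1 ↔ arrivalCount x b = m ∧ x (b + 1) = true := by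
  constructor
  · intro h
    have hne : {u : ℕ | 0 < u ∧ arrivalCount x u = m + 1}.Nonempty :=
      Nat.nonempty_of_pos_sInf (by rw [nthArrival] at h; omega)
    have hmem := Nat.sInf_mem hne
    rw [← nthArrival, h] at hmem
    have hc := hmem.2
    have hb : arrivalCount x b ≠ m + 1 := by
      intro hb
      have hpos : 0 < b := by
        rcases Nat.eq_zero_or_pos b with rfl | h0
        · simp at hb
        · exact h0
      have : nthArrival x (m + 1) ≤ b := Nat.sInf_le ⟨hpos, hb⟩
      omega
    rw [arrivalCount_succ] at hc
    split_ifs at hc with hx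
    · exact ⟨by omega, hx⟩
    · omega
  · rintro ⟨hb, hx⟩
    refine le_antisymm (Nat.sInf_le ⟨by omega, by rw [arrivalCount_succ, hb, if_pos hx]⟩)
      (le_csInf ⟨b + 1, by omega, by rw [arrivalCount_succ, hb, if_pos hx]⟩ fun u hu => ?_)
    by_contra hlt
    have := arrivalCount_mono (x := x) (show u ≤ b by omega)
    have := hu.2
    omega

lemma arrivalCount_nthArrival {m a : ℕ} (h : nthArrival x (m + 1) = a + 1) :
    arrivalCount x (a + 1) = m + 1 := by
  obtain ⟨h1, h2⟩ := nthArrival_succ_eq_succ_iff.1 h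
  rw [arrivalCount_succ, h1, if_pos h2]

lemma arrivalCount_add_eq_iff {a g : ℕ} :
    arrivalCount x (a + g) = arrivalCount x a ↔ ∀ t ∈ Finset.Ioc a (a + g), x t = false := by
  induction g with
  | zero => simp
  | succ g ih =>
    have h1 := arrivalCount_mono (x := x) (show a ≤ a + g by omega)
    rw [← add_assoc, arrivalCount_succ]
    constructor
    · intro h t ht
      split_ifs at h with hx
      · omega
      · rcases eq_or_ne t (a + g + 1) with rfl | hne
        · simpa using hx
        · exact ih.1 (by omega) t (by simp at ht ⊢; omega)
    · intro h
      rw [if_neg (by simp [h (a + g + 1) (by simp)]), add_zero]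
      exact ih.2 fun t ht => h t (by simp at ht ⊢; omega)

lemma nthArrival_succ_eq_add_iff {m a g : ℕ} (ha : nthArrival x (m + 1) = a + 1) :
    nthArrival x (m + 2) = a + 1 + g + 1 ↔
      (∀ t ∈ Finset.Ioc (a + 1) (a + 1 + g), x t = false) ∧ x (a + 1 + g + 1) = true := by
  rw [nthArrival_succ_eq_succ_iff, ← arrivalCount_add_eq_iff, arrivalCount_nthArrival ha]

lemma nthArrival_pos_lt {m a : ℕ} (h : nthArrival x (m + 2) = a + 1) :
    ∃ b < a, nthArrival x (m + 1) = b + 1 := by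
  obtain ⟨h1, h2⟩ := nthArrival_succ_eq_succ_iff.1 h
  have hpos : 0 < a := by
    rcases Nat.eq_zero_or_pos a with rfl | h0
    · simp at h1
    · exact h0
  have hle : nthArrival x (m + 1) ≤ a := Nat.sInf_le ⟨hpos, h1⟩
  have hmem := Nat.sInf_mem (s := {u : ℕ | 0 < u ∧ arrivalCount x u = m + 1}) ⟨a, hpos, h1⟩
  have h0 : 0 < nthArrival x (m + 1) := hmem.1
  exact ⟨nthArrival x (m + 1) - 1, by omega, by omega⟩

lemma exists_arrivalCount_eq (hx : ∀ a, ∃ t > a, x t = true) (m : ℕ) :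
    ∃ u, arrivalCount x u = m := by
  induction m with
  | zero => exact ⟨0, rfl⟩
  | succ m ih =>
    obtain ⟨u, hu⟩ := ih
    obtain ⟨t, ht, hxt⟩ := hx u
    classical
    have hex : ∃ g, x (u + g + 1) = true :=
      ⟨t - u - 1, by rwa [show u + (t - u - 1) + 1 = t by omega]⟩
    refine ⟨u + Nat.find hex + 1, ?_⟩
    rw [arrivalCount_succ, if_pos (Nat.find_spec hex), arrivalCount_add_eq_iff.2, hu]
    intro s hs
    rw [Finset.mem_Ioc] at hs
    have := Nat.find_min hex (m := s - u - 1) (by omega)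
    rw [show u + (s - u - 1) + 1 = s by omega] at this
    simpa using this

lemma nthArrival_pos (hx : ∀ a, ∃ t > a, x t = true) (m : ℕ) : 0 < nthArrival x (m + 1) := by
  obtain ⟨u, hu⟩ := exists_arrivalCount_eq hx (m + 1)
  have hpos : 0 < u := by
    rcases Nat.eq_zero_or_pos u with rfl | h0
    · simp at hu
    · exact h0
  exact (Nat.sInf_mem (s := {u : ℕ | 0 < u ∧ arrivalCount x u = m + 1}) ⟨u, hpos, hu⟩).1

lemma nthArrival_lt_succ (hx : ∀ a, ∃ t > a, x t = true) (m : ℕ) :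
    nthArrival x (m + 1) < nthArrival x (m + 2) := by
  have h := nthArrival_pos hx (m + 1)
  obtain ⟨b, hb, hb'⟩ := nthArrival_pos_lt (x := x) (m := m) (a := nthArrival x (m + 2) - 1)
    (by rw [Nat.sub_add_cancel h])
  omega

end

/-! ### Independence -/

/-- A finite index set splits into its left and right parts; independence of the two blocks
separates them, and each part then factorizes. -/
lemma iIndepFun_sumElim {Ω ι κ α : Type*} [MeasurableSpace Ω] [MeasurableSpace α]
    {P : Measure Ω} {f : ι → Ω → α} {g : κ → Ω → α}
    (hf : iIndepFun f P) (hg : iIndepFun g P)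
    (hfg : IndepFun (fun ω i => f i ω) (fun ω j => g j ω) P) :
    iIndepFun (Sum.elim f g) P := by
  rw [iIndepFun_iff_measure_inter_preimage_eq_mul]
  intro S sets hS
  have hl : ∀ i ∈ S.toLeft, MeasurableSet (sets (.inl i)) := fun i hi =>
    hS _ (Finset.mem_toLeft.1 hi)
  have hr : ∀ i ∈ S.toRight, MeasurableSet (sets (.inr i)) := fun i hi =>
    hS _ (Finset.mem_toRight.1 hi)
  have hset : ⋂ i ∈ S, Sum.elim f g i ⁻¹' sets i =
      (⋂ i ∈ S.toLeft, f i ⁻¹' sets (.inl i)) ∩ ⋂ j ∈ S.toRight, g j ⁻¹' sets (.inr j) := by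
    ext ω
    simp
  have hl' : ⋂ i ∈ S.toLeft, f i ⁻¹' sets (.inl i) =
      (fun ω i => f i ω) ⁻¹' ((S.toLeft : Set ι).pi fun i => sets (.inl i)) := by
    ext ω; simp [Set.pi]
  have hr' : ⋂ i ∈ S.toRight, g i ⁻¹' sets (.inr i) =
      (fun ω i => g i ω) ⁻¹' ((S.toRight : Set κ).pi fun i => sets (.inr i)) := by
    ext ω; simp [Set.pi]
  have hmul := hfg.measure_inter_preimage_eq_mul _ _
    (MeasurableSet.pi S.toLeft.countable_toSet hl) (MeasurableSet.pi S.toRight.countable_toSet hr)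
  rw [hset]
  conv_lhs => rw [hl', hr', hmul, ← hl', ← hr', hf.measure_inter_preimage_eq_mul _ hl,
    hg.measure_inter_preimage_eq_mul _ hr]
  conv_rhs => rw [← Finset.toLeft_disjSum_toRight (u := S), Finset.prod_disjSum]
  rfl

lemma measure_eq_tsum_inter_preimage {Ω : Type*} [MeasurableSpace Ω] {P : Measure Ω} {A : Ω → ℕ}
    (hA : Measurable A) {E : Set Ω} (hE : MeasurableSet E) :
    P E = ∑' a, P (E ∩ {ω | A ω = a}) := by
  have h := measure_iUnion (μ := P) (f := fun a => E ∩ {ω | A ω = a})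
    (fun i j hij => Set.disjoint_left.2 fun ω h1 h2 => hij (h1.2.symm.trans h2.2))
    (fun a => hE.inter (hA (measurableSet_singleton a)))
  rw [← h]
  congr 1
  ext ω
  simp

/-! ### Law of the delays -/

namespace FrameAsyncQueue

variable {Ω : Type*} [MeasurableSpace Ω] {P : Measure Ω} {lam : ℝ} {Pτ : Measure ℕ}
  (Q : FrameAsyncQueue P lam Pτ) {n : ℕ}

lemma arrivalTime_eq_nthArrival (m : ℕ) (ω : Ω) :
    Q.arrivalTime m ω = nthArrival (fun t => Q.arrival t ω) m := rfl

/-- All inputs of the queue as one family of random variables. -/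
def input : ℕ ⊕ ℕ → Ω → ℕ :=
  Sum.elim (fun t ω => (Q.arrival t ω).toNat) Q.frames

lemma measurable_input (i : ℕ ⊕ ℕ) : Measurable (Q.input i) := by
  cases i with
  | inl t => exact (Measurable.of_discrete (f := Bool.toNat)).comp (Q.measurable_arrival t)
  | inr m => exact Q.measurable_frames m

lemma iIndepFun_input : iIndepFun Q.input P := by
  have hm : Measurable fun (x : ℕ → Bool) t => (x t).toNat :=
    measurable_pi_lambda _ fun t =>
      (Measurable.of_discrete (f := Bool.toNat)).comp (measurable_pi_apply t)
  exact iIndepFun_sumElim (Q.indep_arrival.comp (fun _ b => b.toNat) fun _ => .of_discrete)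
    Q.indep_frames (Q.indep_arrival_frames.comp hm measurable_id)

/-! ### Past and future inputs -/

/-- Information carried by the inputs in `S`. -/
@[reducible] def info (S : Set (ℕ ⊕ ℕ)) : MeasurableSpace Ω :=
  ⨆ i ∈ S, MeasurableSpace.comap (Q.input i) inferInstance

lemma info_mono {S T : Set (ℕ ⊕ ℕ)} (h : S ⊆ T) : Q.info S ≤ Q.info T :=
  biSup_mono h

lemma info_le (S : Set (ℕ ⊕ ℕ)) : Q.info S ≤ (inferInstance : MeasurableSpace Ω) :=
  iSup₂_le fun i _ => (Q.measurable_input i).comap_le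

lemma measurable_info_input {S : Set (ℕ ⊕ ℕ)} {i : ℕ ⊕ ℕ} (hi : i ∈ S) :
    Measurable[Q.info S] (Q.input i) :=
  (comap_measurable (Q.input i)).mono (le_biSup (fun i => MeasurableSpace.comap (Q.input i) _) hi)
    le_rfl

lemma indep_info {S T : Set (ℕ ⊕ ℕ)} (h : Disjoint S T) : Indep (Q.info S) (Q.info T) P :=
  indep_iSup_of_disjoint (fun i => (Q.measurable_input i).comap_le) Q.iIndepFun_input h

/-- Arrivals up to channel use `a` and frame numbers of the packets up to the `m`-th one. -/
def pastInputs (a m : ℕ) : Set (ℕ ⊕ ℕ) :=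
  {i | Sum.elim (· ≤ a) (· ≤ m) i}

lemma pastInputs_mono {a b m l : ℕ} (ha : a ≤ b) (hm : m ≤ l) :
    pastInputs a m ⊆ pastInputs b l := by
  rintro (i | i) h
  · exact le_trans h ha
  · exact le_trans h hm

lemma measurableSet_arrival {a m t : ℕ} (ht : t ≤ a) :
    MeasurableSet[Q.info (pastInputs a m)] {ω | Q.arrival t ω = true} := by
  have : {ω | Q.arrival t ω = true} = Q.input (.inl t) ⁻¹' {1} := by
    ext ω
    simp [input]
  rw [this]
  exact Q.measurable_info_input (S := pastInputs a m) ht (measurableSet_singleton 1)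

lemma measurable_arrivalCount {a m b : ℕ} (hb : b ≤ a) :
    Measurable[Q.info (pastInputs a m)] fun ω => arrivalCount (fun t => Q.arrival t ω) b := by
  unfold arrivalCount
  refine Finset.measurable_fun_sum _ fun t ht => ?_
  exact Measurable.ite (Q.measurableSet_arrival ((Finset.mem_Icc.1 ht).2.trans hb))
    measurable_const measurable_const

lemma measurableSet_arrivalTime_eq (a m k : ℕ) :
    MeasurableSet[Q.info (pastInputs (a + 1) k)] {ω | Q.arrivalTime (m + 1) ω = a + 1} := by
  simp_rw [arrivalTime_eq_nthArrival, nthArrival_succ_eq_succ_iff]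
  exact (Q.measurable_arrivalCount (by omega) (measurableSet_singleton m)).inter
    (Q.measurableSet_arrival le_rfl)

lemma measurable_arrivalTime (m : ℕ) : Measurable (Q.arrivalTime (m + 1)) := by
  have h : ∀ a, MeasurableSet {ω | Q.arrivalTime (m + 1) ω = a + 1} := fun a =>
    Q.info_le _ _ (Q.measurableSet_arrivalTime_eq a m 0)
  refine measurable_to_countable' fun a => ?_
  cases a with
  | succ a => exact h a
  | zero =>
    have : Q.arrivalTime (m + 1) ⁻¹' {0} = (⋃ a, {ω | Q.arrivalTime (m + 1) ω = a + 1})ᶜ := by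
      ext ω
      simp only [Set.mem_preimage, Set.mem_singleton_iff, Set.mem_compl_iff, Set.mem_iUnion,
        Set.mem_ofPred_eq, not_exists]
      refine ⟨fun h a => by omega, fun h => ?_⟩
      by_contra h0
      exact h (Q.arrivalTime (m + 1) ω - 1) (by omega)
    rw [this]
    exact (MeasurableSet.iUnion h).compl

lemma measurable_departureTime (n m : ℕ) : Measurable (Q.departureTime n m) := by
  induction m with
  | zero => exact measurable_const
  | succ m ih =>
    exact ((Q.measurable_arrivalTime m).max ih).add ((Q.measurable_frames (m + 1)).const_mul n)

lemma measurable_delay (n m : ℕ) : Measurable (Q.delay n (m + 1)) :=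
  (Q.measurable_departureTime n (m + 1)).sub (Q.measurable_arrivalTime m)

/-- Fixing the arrival time confines the event to finitely many channel uses. The induction splits
over the arrival and departure of the previous packet; on each piece the departure is a function of
one frame number. -/
lemma measurableSet_departureTime_eq (a m d : ℕ) :
    MeasurableSet[Q.info (pastInputs (a + 1) (m + 1))]
      {ω | Q.arrivalTime (m + 1) ω = a + 1 ∧ Q.departureTime n (m + 1) ω = d} := by
  have hfr : ∀ a m e, MeasurableSet[Q.info (pastInputs (a + 1) (m + 1))]
      {ω | max (a + 1) e + n * Q.frames (m + 1) ω = d} := fun a m e =>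
    Q.measurable_info_input (S := pastInputs (a + 1) (m + 1)) (i := .inr (m + 1)) (le_refl (m + 1))
      (MeasurableSet.of_discrete (s := {k | max (a + 1) e + n * k = d}))
  induction m generalizing a d with
  | zero =>
    convert (Q.measurableSet_arrivalTime_eq a 0 1).inter (hfr a 0 0) using 1
    ext ω
    simp only [departureTime, Set.mem_ofPred_eq, Set.mem_inter_iff]
    refine and_congr_right fun h => ?_
    rw [h]
  | succ m ih =>
    -- The previous arrival `b + 1` is strictly earlier than `a + 1`, hence `b : Fin a`.
    have hU : MeasurableSet[Q.info (pastInputs (a + 1) (m + 2))]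
        (⋃ b : Fin a, ⋃ e : ℕ,
          {ω | Q.arrivalTime (m + 1) ω = b + 1 ∧ Q.departureTime n (m + 1) ω = e} ∩
          ({ω | Q.arrivalTime (m + 2) ω = a + 1} ∩
            {ω | max (a + 1) e + n * Q.frames (m + 2) ω = d})) := by
      refine MeasurableSet.iUnion fun b => MeasurableSet.iUnion fun e => ?_
      refine MeasurableSet.inter ?_
        ((Q.measurableSet_arrivalTime_eq a (m + 1) (m + 2)).inter (hfr a (m + 1) e))
      refine Q.info_mono (pastInputs_mono (by omega) (by omega)) _ (ih b e fun a m' e => ?_)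
      exact Q.measurable_info_input (S := pastInputs (a + 1) (m' + 1)) (i := .inr (m' + 1))
        (le_refl (m' + 1)) (MeasurableSet.of_discrete (s := {k | max (a + 1) e + n * k = _}))
    convert hU using 1
    ext ω
    simp only [Set.mem_ofPred_eq, Set.mem_inter_iff, Set.mem_iUnion]
    constructor
    · rintro ⟨h1, h2⟩
      obtain ⟨b, hb, hb'⟩ := nthArrival_pos_lt (x := fun t => Q.arrival t ω) h1
      refine ⟨⟨b, hb⟩, Q.departureTime n (m + 1) ω, ⟨hb', rfl⟩, h1, ?_⟩
      rw [← h2, ← h1]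
      rfl
    · rintro ⟨b, e, ⟨h1, h2⟩, h3, h4⟩
      refine ⟨h3, ?_⟩
      rw [← h4, ← h2, ← h3]
      rfl

lemma measurableSet_delay_eq (a m d : ℕ) :
    MeasurableSet[Q.info (pastInputs (a + 1) (m + 1))]
      {ω | Q.arrivalTime (m + 1) ω = a + 1 ∧ Q.delay n (m + 1) ω = d} := by
  have hU : MeasurableSet[Q.info (pastInputs (a + 1) (m + 1))]
      (⋃ e ∈ {e : ℕ | e - (a + 1) = d},
        {ω | Q.arrivalTime (m + 1) ω = a + 1 ∧ Q.departureTime n (m + 1) ω = e}) :=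
    MeasurableSet.biUnion (Set.to_countable _) fun e _ =>
      Q.measurableSet_departureTime_eq a m e
  convert hU using 1
  ext ω
  simp only [delay, Set.mem_ofPred_eq, Set.mem_iUnion, exists_prop]
  constructor
  · rintro ⟨h1, h2⟩
    exact ⟨_, by rw [← h1]; exact h2, h1, rfl⟩
  · rintro ⟨e, h1, h2, h3⟩
    exact ⟨h2, by rw [h2, h3]; exact h1⟩

lemma measure_arrival_false [IsProbabilityMeasure P] (t : ℕ) (h0 : 0 ≤ lam) :
    P {ω | Q.arrival t ω = false} = ENNReal.ofReal (1 - lam) := by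
  have : {ω | Q.arrival t ω = false} = {ω | Q.arrival t ω = true}ᶜ := by
    ext ω; simp
  have hm : MeasurableSet {ω | Q.arrival t ω = true} :=
    Q.measurable_arrival t (measurableSet_singleton true)
  rw [this, prob_compl_eq_one_sub hm,
    Q.arrival_law, ENNReal.ofReal_sub _ h0, ENNReal.ofReal_one]

/-- Given an event of the past up to channel use `a`, the next arrival comes `g + 1` channel uses
later and packet `m + 1` needs `k` frames with the geometric probability of `g` times `Pτ {k}`. -/
lemma measure_past_inter_next [IsProbabilityMeasure P] (h0 : 0 ≤ lam) {a m : ℕ} (g k : ℕ)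
    {E : Set Ω} (hE : MeasurableSet[Q.info (pastInputs a m)] E) :
    P (E ∩ {ω | ((∀ t ∈ Finset.Ioc a (a + g), Q.arrival t ω = false) ∧
      Q.arrival (a + g + 1) ω = true) ∧ Q.frames (m + 1) ω = k}) =
      P E * (ENNReal.ofReal ((1 - lam) ^ g * lam) * Pτ {k}) := by
  -- The inputs that decide the next gap and frame number, all outside `pastInputs a m`.
  set T : Finset (ℕ ⊕ ℕ) := (Finset.Ioc a (a + g + 1)).disjSum {m + 1} with hT
  set sets : ℕ ⊕ ℕ → Set ℕ := Sum.elim (fun t => if t = a + g + 1 then {1} else {0})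
    (fun _ => {k}) with hsets
  have hF : {ω | ((∀ t ∈ Finset.Ioc a (a + g), Q.arrival t ω = false) ∧
      Q.arrival (a + g + 1) ω = true) ∧ Q.frames (m + 1) ω = k} =
      ⋂ i ∈ T, Q.input i ⁻¹' sets i := by
    ext ω
    simp only [Set.mem_ofPred_eq, Set.mem_iInter, hT, Finset.mem_disjSum, Finset.mem_singleton]
    constructor
    · rintro ⟨⟨h1, h2⟩, h3⟩ i (⟨t, ht, rfl⟩ | ⟨j, rfl, rfl⟩)
      · by_cases hta : t = a + g + 1
        · subst hta
          simp [hsets, input, h2]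
        · have := h1 t (by rw [Finset.mem_Ioc] at ht ⊢; omega)
          simp [hsets, input, hta, this]
      · simp [hsets, input, h3]
    · intro h
      refine ⟨⟨fun t ht => ?_, ?_⟩, ?_⟩
      · rw [Finset.mem_Ioc] at ht
        have := h (.inl t) (.inl ⟨t, by rw [Finset.mem_Ioc]; omega, rfl⟩)
        have hne : t ≠ a + g + 1 := by omega
        simpa [hsets, input, hne] using this
      · have := h (.inl (a + g + 1)) (.inl ⟨_, by rw [Finset.mem_Ioc]; omega, rfl⟩)
        simpa [hsets, input] using this
      · have := h (.inr (m + 1)) (.inr ⟨_, rfl, rfl⟩)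
        simpa [hsets, input] using this
  have hdisj : Disjoint (pastInputs a m) (T : Set (ℕ ⊕ ℕ)) := by
    rw [Set.disjoint_left]
    rintro (t | j) h1 h2
    · have h1' : t ≤ a := h1
      simp [hT] at h2
      omega
    · have h1' : j ≤ m := h1
      simp [hT] at h2
      omega
  have hFm : MeasurableSet[Q.info T] (⋂ i ∈ T, Q.input i ⁻¹' sets i) :=
    MeasurableSet.biInter T.countable_toSet fun i hi =>
      Q.measurable_info_input (S := T) hi .of_discrete
  rw [hF, (Indep_iff _ _ _).1 (Q.indep_info hdisj) _ _ hE hFm,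
    Q.iIndepFun_input.measure_inter_preimage_eq_mul T fun _ _ => .of_discrete, hT,
    Finset.prod_disjSum, Finset.prod_singleton, Finset.prod_Ioc_succ_top (by omega)]
  congr 1
  have htrue : P (Q.input (.inl (a + g + 1)) ⁻¹' sets (.inl (a + g + 1))) = ENNReal.ofReal lam := by
    rw [← Q.arrival_law (a + g + 1)]
    congr 1
    ext ω
    simp [hsets, input]
  have hfalse : ∀ t ∈ Finset.Ioc a (a + g), P (Q.input (.inl t) ⁻¹' sets (.inl t)) =
      ENNReal.ofReal (1 - lam) := by
    intro t ht
    rw [Finset.mem_Ioc] at ht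
    have hne : t ≠ a + g + 1 := by omega
    rw [← Q.measure_arrival_false t h0]
    congr 1
    ext ω
    simp [hsets, input, hne]
  have hframes : P (Q.input (.inr (m + 1)) ⁻¹' sets (.inr (m + 1))) = Pτ {k} :=
    (Measure.map_apply (Q.measurable_frames (m + 1)) .of_discrete).symm.trans
      (congrArg (fun ν : Measure ℕ => ν {k}) (Q.frames_law (m + 1)))
  have h1 : lam ≤ 1 := by
    have := Q.arrival_law 0 ▸ prob_le_one (μ := P) (s := {ω | Q.arrival 0 ω = true})
    simpa using this
  rw [htrue, hframes, Finset.prod_congr rfl hfalse, Finset.prod_const, Nat.card_Ioc,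
    Nat.add_sub_cancel_left, ENNReal.ofReal_mul (pow_nonneg (by linarith) g),
    ENNReal.ofReal_pow (by linarith)]

/-- Second Borel–Cantelli lemma: the arrivals are independent with constant positive probability. -/
lemma ae_frequently_arrival [IsProbabilityMeasure P] (h0 : 0 < lam) :
    ∀ᵐ ω ∂P, ∀ a, ∃ t > a, Q.arrival t ω = true := by
  have hm : ∀ t, MeasurableSet {ω | Q.arrival t ω = true} := fun t =>
    Q.measurable_arrival t (measurableSet_singleton true)
  have hind : iIndepSet (fun t => {ω | Q.arrival t ω = true}) P := by
    rw [iIndepSet_iff_meas_biInter hm]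
    intro S
    exact Q.indep_arrival.measure_inter_preimage_eq_mul S (sets := fun _ => {true})
      fun _ _ => measurableSet_singleton _
  have h := measure_limsup_eq_one hm hind (by
    simp_rw [Q.arrival_law]
    exact ENNReal.tsum_const_eq_top_of_ne_zero (by simpa using h0))
  have hae : ∀ᵐ ω ∂P, ω ∈ limsup (fun t => {ω | Q.arrival t ω = true}) atTop :=
    (mem_ae_iff_prob_eq_one (MeasurableSet.measurableSet_limsup hm)).2 h
  filter_upwards [hae] with ω hω a
  rw [mem_limsup_iff_frequently_mem, frequently_atTop] at hω
  obtain ⟨t, ht, hω⟩ := hω (a + 1)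
  exact ⟨t, ht, hω⟩

end FrameAsyncQueue

/-! ### The recursion for the laws of the delays -/

lemma delayStep_eq_map {p : unitInterval} {n : ℕ} {τ μ : Measure ℕ} [IsProbabilityMeasure μ]
    [IsProbabilityMeasure τ] :
    delayStep p n τ μ = ((μ.prod (geometricMeasure p)).prod τ).map
      fun z => z.1.1 - (z.1.2 + 1) + n * z.2 := by
  have h := Measure.map_prod_map (μ.prod (geometricMeasure p)) τ
    (f := fun z : ℕ × ℕ => z.1 - (z.2 + 1)) (g := id) .of_discrete measurable_id
  rw [Measure.map_id] at h
  rw [delayStep, waitStep, h, Measure.map_map .of_discrete .of_discrete]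
  rfl

/-- Lets the first packet count as the successor of a fictitious packet with delay `0`: it never
waits. -/
lemma delayStep_dirac_zero {p : unitInterval} {n : ℕ} {τ : Measure ℕ}
    [IsProbabilityMeasure τ] :
    delayStep p n τ (Measure.dirac 0) = τ.map fun k => n * k := by
  have h : waitStep p (Measure.dirac 0) = Measure.dirac 0 := by
    rw [waitStep, Measure.dirac_prod, Measure.map_map .of_discrete .of_discrete]
    have : (fun z : ℕ × ℕ => z.1 - (z.2 + 1)) ∘ Prod.mk 0 = fun _ => 0 := by
      funext g; simp
    rw [this, Measure.map_const]
    simp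
  rw [delayStep, h, Measure.dirac_prod, Measure.map_map .of_discrete .of_discrete]
  congr 1
  funext k
  simp

namespace FrameAsyncQueue

variable {Ω : Type*} [MeasurableSpace Ω] {P : Measure Ω} {lam : ℝ} {Pτ : Measure ℕ}
  (Q : FrameAsyncQueue P lam Pτ) {n : ℕ}

/-- Lindley's recursion. The gap appears as `g + 1`, with `g` the number of channel uses without
arrival in between, to match `waitStep`. -/
lemma delay_succ (m : ℕ) {ω : Ω}
    (h : Q.arrivalTime (m + 1) ω < Q.arrivalTime (m + 2) ω) :
    Q.delay n (m + 2) ω = Q.delay n (m + 1) ω -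
      (Q.arrivalTime (m + 2) ω - Q.arrivalTime (m + 1) ω - 1 + 1) + n * Q.frames (m + 2) ω := by
  have : Q.departureTime n (m + 2) ω = max (Q.arrivalTime (m + 2) ω)
    (Q.departureTime n (m + 1) ω) + n * Q.frames (m + 2) ω := rfl
  simp only [delay, this]
  omega

/-- On each event that the current arrival time is `a + 1`, past and future inputs factorize. The
future factor does not depend on `a`, so the sum over `a` reassembles the law of the delay. -/
lemma measure_delay_gap_frames [IsProbabilityMeasure P] (h0 : 0 < lam) (m d g k : ℕ) :
    P {ω | (Q.delay n (m + 1) ω = d ∧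
      Q.arrivalTime (m + 2) ω - Q.arrivalTime (m + 1) ω - 1 = g) ∧ Q.frames (m + 2) ω = k} =
      P {ω | Q.delay n (m + 1) ω = d} * (ENNReal.ofReal ((1 - lam) ^ g * lam) * Pτ {k}) := by
  have hD := Q.measurable_delay n m
  have hA := Q.measurable_arrivalTime m
  have hA' := Q.measurable_arrivalTime (m + 1)
  have hF := Q.measurable_frames (m + 2)
  have hE : MeasurableSet {ω | (Q.delay n (m + 1) ω = d ∧
      Q.arrivalTime (m + 2) ω - Q.arrivalTime (m + 1) ω - 1 = g) ∧ Q.frames (m + 2) ω = k} :=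
    ((hD (measurableSet_singleton d)).inter
      (((hA'.sub hA).sub measurable_const) (measurableSet_singleton g))).inter
      (hF (measurableSet_singleton k))
  have hEd : MeasurableSet {ω | Q.delay n (m + 1) ω = d} := hD (measurableSet_singleton d)
  rw [measure_eq_tsum_inter_preimage hA hE,
    measure_eq_tsum_inter_preimage hA hEd, ← ENNReal.tsum_mul_right]
  refine tsum_congr fun a => ?_
  have hae := Q.ae_frequently_arrival h0
  cases a with
  -- Arrival time `0` is the default value of `sInf ∅`, taken only on a null event.
  | zero =>
    have hz : P {ω | Q.arrivalTime (m + 1) ω = 0} = 0 := by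
      rw [← compl_mem_ae_iff]
      filter_upwards [hae] with ω hω h
      exact (nthArrival_pos hω m).ne' h
    rw [measure_mono_null Set.inter_subset_right hz, measure_mono_null Set.inter_subset_right hz,
      zero_mul]
  | succ a =>
    rw [← Q.measure_past_inter_next h0.le g k
      (a := a + 1) (m := m + 1)
      (E := {ω | Q.delay n (m + 1) ω = d} ∩ {ω | Q.arrivalTime (m + 1) ω = a + 1})
      (by convert Q.measurableSet_delay_eq a m d (n := n) using 1; ext ω; simp [and_comm])]
    refine measure_congr ?_
    filter_upwards [hae] with ω hω
    refine propext ?_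
    change (((_ ∧ _) ∧ _) ∧ _) ↔ ((_ ∧ _) ∧ _ ∧ _)
    have hlt : Q.arrivalTime (m + 1) ω < Q.arrivalTime (m + 2) ω := nthArrival_lt_succ hω m
    have key : Q.arrivalTime (m + 1) ω = a + 1 →
        (Q.arrivalTime (m + 2) ω - Q.arrivalTime (m + 1) ω - 1 = g ↔
        ((∀ t ∈ Finset.Ioc (a + 1) (a + 1 + g), Q.arrival t ω = false) ∧
          Q.arrival (a + 1 + g + 1) ω = true)) := fun h => by
      rw [← nthArrival_succ_eq_add_iff (x := fun t => Q.arrival t ω) h,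
        ← arrivalTime_eq_nthArrival]
      omega
    constructor
    · rintro ⟨⟨⟨h1, h2⟩, h3⟩, h4⟩
      exact ⟨⟨h1, h4⟩, (key h4).1 h2, h3⟩
    · rintro ⟨⟨h1, h4⟩, h2, h3⟩
      exact ⟨⟨⟨h1, (key h4).2 h2⟩, h3⟩, h4⟩

lemma isProbabilityMeasure_framesLaw (Q : FrameAsyncQueue P lam Pτ) [IsProbabilityMeasure P] :
    IsProbabilityMeasure Pτ := by
  have h := Measure.isProbabilityMeasure_map (μ := P) (Q.measurable_frames 0).aemeasurable
  rwa [Q.frames_law] at h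

lemma map_delay_one [IsProbabilityMeasure P] (p : unitInterval) :
    P.map (Q.delay n 1) = delayStep p n Pτ (Measure.dirac 0) := by
  have := Q.isProbabilityMeasure_framesLaw
  have h : Q.delay n 1 = (fun k => n * k) ∘ Q.frames 1 := by
    funext ω
    simp [delay, departureTime]
  rw [delayStep_dirac_zero, h, ← Measure.map_map .of_discrete (Q.measurable_frames 1),
    Q.frames_law]

lemma map_delay_succ [IsProbabilityMeasure P] {p : unitInterval} (hp : (p : ℝ) = lam)
    (h0 : 0 < lam) (m : ℕ) :
    P.map (Q.delay n (m + 2)) = delayStep p n Pτ (P.map (Q.delay n (m + 1))) := by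
  have := Q.isProbabilityMeasure_framesLaw
  have hD := Q.measurable_delay n m
  have := Measure.isProbabilityMeasure_map (μ := P) hD.aemeasurable
  have hp0 : p ≠ 0 := by
    rintro rfl
    simp at hp
    exact h0.ne hp
  set Z : Ω → (ℕ × ℕ) × ℕ := fun ω => ((Q.delay n (m + 1) ω,
    Q.arrivalTime (m + 2) ω - Q.arrivalTime (m + 1) ω - 1), Q.frames (m + 2) ω) with hZ
  have hZm : Measurable Z :=
    (hD.prodMk (((Q.measurable_arrivalTime (m + 1)).sub (Q.measurable_arrivalTime m)).sub
      measurable_const)).prodMk (Q.measurable_frames (m + 2))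
  have hlaw : P.map Z = ((P.map (Q.delay n (m + 1))).prod (geometricMeasure p)).prod Pτ := by
    refine Measure.ext_of_singleton fun ⟨⟨d, g⟩, k⟩ => ?_
    rw [← Set.singleton_prod_singleton, ← Set.singleton_prod_singleton, Measure.prod_prod,
      Measure.prod_prod, geometricMeasure_singleton hp0, hp, mul_assoc,
      Measure.map_apply hD .of_discrete, Measure.map_apply hZm .of_discrete]
    refine Eq.trans ?_ (Q.measure_delay_gap_frames h0 m d g k)
    congr 1
  rw [delayStep_eq_map, ← hlaw, Measure.map_map .of_discrete hZm]
  refine Measure.map_congr ?_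
  filter_upwards [Q.ae_frequently_arrival h0] with ω hω
  exact Q.delay_succ m (nthArrival_lt_succ hω m)

end FrameAsyncQueue

/-- Generating function of the stationary delay. -/
lemma pgf_of_delayStep_eq {p : unitInterval} (hp : p ≠ 0) {n : ℕ} {τ π : Measure ℕ}
    [IsProbabilityMeasure τ] [IsProbabilityMeasure π] {ρ : ℝ} (hρ : ρ < 1)
    (hπ : delayStep p n τ π = π) (hidle : ∫ d, (1 - p : ℝ) ^ d ∂π = 1 - ρ)
    {s : ℂ} (hs1 : s ≠ 1) (hs : Integrable (fun d : ℕ => s ^ d) π) :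
    s - 1 + (p : ℝ) * (1 - pgf τ (s ^ n)) ≠ 0 ∧
      pgf π s = (1 - ρ : ℝ) * (s - 1) * pgf τ (s ^ n) /
        (s - 1 + (p : ℝ) * (1 - pgf τ (s ^ n))) := by
  have hidle' : ∫ d, ((1 - p : ℝ) : ℂ) ^ d ∂π = ((1 - ρ : ℝ) : ℂ) := by
    rw [← hidle, ← integral_complex_ofReal]
    simp
  have hwait := integral_pow_waitStep hp hs
  have hprod := integral_pow_delayStep (p := p) (n := n) (τ := τ) (μ := π) s
  rw [hπ] at hprod
  simp only [Complex.coe_algebraMap] at hwait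
  rw [hidle', hprod] at hwait
  rw [pgf, pgf, hprod]
  set G : ℂ := ∫ k, (s ^ n) ^ k ∂τ
  set V : ℂ := ∫ w, s ^ w ∂(waitStep p π)
  -- The one-step identity with `E[s ^ D] = V * G`. Its right side is nonzero since `s ≠ 1` and `ρ <
  -- 1`, so the denominator cannot vanish.
  have key : V * (s - 1 + (p : ℝ) * (1 - G)) = (s - 1) * ((1 - ρ : ℝ) : ℂ) := by
    push_cast at hwait ⊢
    linear_combination hwait
  have hne : s - 1 + (p : ℝ) * (1 - G) ≠ 0 := by
    intro h
    rw [h, mul_zero, eq_comm, mul_eq_zero, sub_eq_zero, Complex.ofReal_eq_zero] at key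
    rcases key with h | h
    · exact hs1 h
    · linarith
  refine ⟨hne, ?_⟩
  rw [eq_div_iff hne]
  linear_combination G * key

/-- Steady-state delay of the frame-asynchronous queue. The formula is claimed at every complex
`s ≠ 1` at which `E[s ^ D]` converges absolutely, in particular on the closed unit disc. -/
theorem theorem5 {U X Y Ω : Type*} [MeasurableSpace U] [MeasurableSpace X] [MeasurableSpace Y]
    [MeasurableSpace Ω] (W : Kernel X Y) [IsMarkovKernel W]
    (n k : ℕ) (hn : 0 < n) (Pτ : Measure ℕ) (ε : ℝ) (code : VLSFCode U W n k Pτ ε)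
    (lam : ℝ) (hlam0 : 0 < lam) (hlam1 : lam ≤ 1)
    (hmean : Integrable (fun t : ℕ => (t : ℝ)) Pτ) (hstable : lam * n * meanOf Pτ < 1)
    (P : Measure Ω) [IsProbabilityMeasure P] (Q : FrameAsyncQueue P lam Pτ) :
    ∃ π : Measure ℕ, IsSteadyStateLaw P (Q.delay n) π ∧
      ∀ s : ℂ, s ≠ 1 → Integrable (fun d : ℕ => s ^ d) π →
        s - 1 + lam * (1 - pgf Pτ (s ^ n)) ≠ 0 ∧
        pgf π s = (1 - lam * n * meanOf Pτ : ℝ) * (s - 1) * pgf Pτ (s ^ n) /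
          (s - 1 + lam * (1 - pgf Pτ (s ^ n))) := by
  have := Q.isProbabilityMeasure_framesLaw
  set p : unitInterval := ⟨lam, hlam0.le, hlam1⟩ with hpdef
  have hp : p ≠ 0 := fun h => hlam0.ne' (congrArg Subtype.val h)
  -- Index `0` is the fictitious packet of delay `0`; index `m + 1` is the actual packet `m + 1`.
  set μ : ℕ → Measure ℕ := fun m => Nat.casesOn m (Measure.dirac 0)
    fun m => P.map (Q.delay n (m + 1)) with hμ
  have hrec : ∀ m, μ (m + 1) = delayStep p n Pτ (μ m) := by
    rintro (_ | m)
    · exact Q.map_delay_one p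
    · exact Q.map_delay_succ rfl hlam0 m
  obtain ⟨π, hπ, hlim, hstat, hidle⟩ :=
    exists_stationary_delayStep hp hmean hstable μ rfl hrec
  refine ⟨π, ⟨hπ, fun d => ?_⟩, fun s hs1 hs =>
    pgf_of_delayStep_eq hp hstable hstat hidle hs1 hs⟩
  rw [← tendsto_add_atTop_iff_nat 1]
  refine ((tendsto_add_atTop_iff_nat 1).2 (hlim d)).congr fun m => ?_
  exact Measure.map_apply (Q.measurable_delay n m) .of_discrete
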